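/- Let $(\mathcal K,\prec_{\mathcal K})$ be an abstract elementary class (in a finitary one-sorted signature) with the amalgamation property and the joint embedding property, and let $\mathrm{LS}(\mathcal K)$ be its Löwenheim–Skolem number, i.e. the least infinite cardinal $\kappa$ such that for every $M\in\mathcal K$ and $A\subseteq M$ there is $M_0\prec_{\mathcal K}M$ with $A\subseteq M_0$ and $|M_0|\le|A|+\kappa$. For $M\in\mathcal K$ let $\text{ga-S}(M)$ be the set of Galois types over $M$, that is, of the classes of triples $(f,N,a)$ with $f:M\to N$ a strong embedding into some $N\in\mathcal K$ and $a\in N$, where $(f_1,N_1,a_1)$ and $(f_2,N_2,a_2)$ are equivalent if there are strong embeddings $g_i:N_i\to N$ into some $N\in\mathcal K$ with $g_1f_1=g_2f_2$ and $g_1(a_1)=g_2(a_2)$. (When $\mathcal K$ has a monster model, these are the orbits in it of the automorphisms fixing $M$ pointwise.) The class $\mathcal K$ is $\chi$-tame if for every $M\in\mathcal K$ and all distinct $p,p'\in\text{ga-S}(M)$ there is $N\prec_{\mathcal K}M$ with $|N|\le\chi$ and $p\restriction N\ne p'\restriction N$; it is $\nu$-stable if $|\text{ga-S}(M)|=\nu$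 for every $M\in\mathcal K$ of cardinality $\nu$. Suppose that $\mathcal K$ is $\chi$-tame for some $\chi\ge\mathrm{LS}(\mathcal K)$ and $\lambda$-stable for some $\lambda\ge\chi$ with $\lambda^{\aleph_0}>\lambda$. Let $\mu$ be a cardinal with $\mathrm{cf}(\mu)>\lambda$, let $\kappa<\mu$, and suppose that there is a set of cardinals $S$, cofinal in the interval $[\kappa,\mu)$, such that $\mathcal K$ is $\nu$-stable for every $\nu\in S$. Then $\mathcal K$ is $\mu$-stable. -/

import Mathlib

open FirstOrder FirstOrder.Language Cardinal

universe u

/-- An abstract elementary class of structures in the (finitary, one-sorted) signature `L`: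
a class `Mem` of `L`-structures, and a relation `Strong S`, read "`S` is a strong submodel of
`M`", for `S` a substructure of `M`.  That strong submodels are substructures
(and that the relation is antisymmetric) is built into the form of `Strong`. -/
structure AEC (L : FirstOrder.Language.{u, u}) where
  /-- membership in the class -/
  Mem : (M : Type u) → [L.Structure M] → Prop
  /-- `Strong S` : the substructure `S` of `M` is a strong submodel of `M` -/
  Strong : {M : Type u} → [L.Structure M] → L.Substructure M → Prop
  /-- the strong submodel relation relates members of the class only -/
  mem_of_strong : ∀ {M : Type u} [L.Structure M] {S : L.Substructure M},
    Strong S → Mem S ∧ Mem M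
  /-- the class is closed under isomorphism -/
  mem_iso : ∀ {M N : Type u} [L.Structure M] [L.Structure N] (_ : M ≃[L] N), Mem M → Mem N
  /-- the strong submodel relation is closed under isomorphism -/
  strong_iso : ∀ {M N : Type u} [L.Structure M] [L.Structure N] (e : M ≃[L] N)
    {S : L.Substructure M}, Strong S → Strong (S.map e.toHom)
  /-- reflexivity -/
  strong_refl : ∀ {M : Type u} [L.Structure M], Mem M → Strong (⊤ : L.Substructure M)
  /-- transitivity -/
  strong_trans : ∀ {M : Type u} [L.Structure M] {S : L.Substructure M} {T : L.Substructure S},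
    Strong T → Strong S → Strong (T.map S.subtype.toHom)
  /-- Unions of chains.  The chain `(S i)`, indexed by a nonempty well-ordered set, consists of
  substructures of an arbitrary ambient `L`-structure `U`, not assumed to be in the class (for
  an abstract chain, take for `U` the union of the chain).  It is increasing for the strong
  submodel relation and continuous, and `T` is its union.  Then `T` is in the class, each `S i` is
  a strong submodel of `T`, and `T` is a strong submodel of any structure of which all the `S i`
  are strong submodels. -/
  chain : ∀ {U : Type u} [L.Structure U] {ι : Type u} [LinearOrder ι] [WellFoundedLT ι]
    [Nonempty ι] (S : ι → L.Substructure U) (T : L.Substructure U),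
    (∀ i j, i ≤ j → S i ≤ S j ∧ Strong ((S i).comap (S j).subtype.toHom)) →
    (∀ i, Order.IsSuccLimit i → (S i : Set U) = ⋃ j ∈ Set.Iio i, (S j : Set U)) →
    (T : Set U) = ⋃ i, (S i : Set U) →
    Mem T ∧ (∀ i, Strong ((S i).comap T.subtype.toHom)) ∧ ((∀ i, Strong (S i)) → Strong T)
  /-- coherence -/
  coherence : ∀ {M : Type u} [L.Structure M] {S₀ S₁ : L.Substructure M},
    Strong S₀ → Strong S₁ → S₀ ≤ S₁ → Strong (S₀.comap S₁.subtype.toHom)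
  /-- downward Löwenheim–Skolem -/
  exists_LS : ∃ κ : Cardinal.{u}, ℵ₀ ≤ κ ∧ ∀ (M : Type u) [L.Structure M], Mem M →
    ∀ A : Set M, ∃ S : L.Substructure M, A ⊆ S ∧ Strong S ∧ #S ≤ #A + κ

namespace AEC

variable {L : FirstOrder.Language.{u, u}} (K : AEC L)

/-- The Löwenheim–Skolem number: the least infinite cardinal which witnesses the downward
Löwenheim–Skolem axiom. -/
noncomputable def LS : Cardinal.{u} :=
  sInf {κ | ℵ₀ ≤ κ ∧ ∀ (M : Type u) [L.Structure M], K.Mem M →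
    ∀ A : Set M, ∃ S : L.Substructure M, A ⊆ S ∧ K.Strong S ∧ #S ≤ #A + κ}

/-- Strong embeddings: embeddings whose image is a strong submodel of the target. -/
def IsStrongEmb {M N : Type u} [L.Structure M] [L.Structure N] (f : M ↪[L] N) : Prop :=
  K.Strong f.toHom.range

variable {K} in
theorem IsStrongEmb.comp {M N P : Type u} [L.Structure M] [L.Structure N] [L.Structure P]
    {g : N ↪[L] P} {f : M ↪[L] N} (hg : K.IsStrongEmb g) (hf : K.IsStrongEmb f) :
    K.IsStrongEmb (g.comp f) := by
  have h := K.strong_trans (K.strong_iso g.equivRange hf) hg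
  have e : ((f.toHom.range.map g.equivRange.toHom).map g.toHom.range.subtype.toHom)
      = (g.comp f).toHom.range := by
    ext x
    simp only [Substructure.mem_map, Hom.mem_range]
    constructor
    · rintro ⟨_, ⟨_, ⟨m, rfl⟩, rfl⟩, rfl⟩
      exact ⟨m, rfl⟩
    · rintro ⟨m, rfl⟩
      exact ⟨_, ⟨_, ⟨m, rfl⟩, rfl⟩, rfl⟩
  rw [e] at h
  exact h

variable {K} in
theorem Strong.isStrongEmb_subtype {M : Type u} [L.Structure M] {S : L.Substructure M}
    (hS : K.Strong S) : K.IsStrongEmb S.subtype := by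
  have e : S.subtype.toHom.range = S := by
    ext x
    simp [Hom.mem_range]
  unfold IsStrongEmb
  rw [e]
  exact hS

/-- Joint embedding property. -/
def JEP : Prop :=
  ∀ (M₁ M₂ : Type u) [L.Structure M₁] [L.Structure M₂], K.Mem M₁ → K.Mem M₂ →
    ∃ (N : Type u) (_ : L.Structure N) (f₁ : M₁ ↪[L] N) (f₂ : M₂ ↪[L] N),
      K.IsStrongEmb f₁ ∧ K.IsStrongEmb f₂

/-- Amalgamation property. -/
def AP : Prop :=
  ∀ (M₀ M₁ M₂ : Type u) [L.Structure M₀] [L.Structure M₁] [L.Structure M₂]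
    (f₁ : M₀ ↪[L] M₁) (f₂ : M₀ ↪[L] M₂), K.IsStrongEmb f₁ → K.IsStrongEmb f₂ →
    ∃ (N : Type u) (_ : L.Structure N) (g₁ : M₁ ↪[L] N) (g₂ : M₂ ↪[L] N),
      K.IsStrongEmb g₁ ∧ K.IsStrongEmb g₂ ∧ g₁.comp f₁ = g₂.comp f₂

/-- A strong extension of `M` together with a point of it. -/
structure PointedExt (M : Type u) [L.Structure M] where
  carrier : Type u
  [str : L.Structure carrier]
  emb : M ↪[L] carrier
  strong : K.IsStrongEmb emb
  pt : carrier

attribute [instance] PointedExt.str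

variable {K} in
/-- Two pointed strong extensions of `M` are related if they embed strongly into a common
structure, over `M` and with the same image of the points. -/
def PointedExt.Rel {M : Type u} [L.Structure M] (A B : K.PointedExt M) : Prop :=
  ∃ (P : Type u) (_ : L.Structure P) (g : A.carrier ↪[L] P) (h : B.carrier ↪[L] P),
    K.IsStrongEmb g ∧ K.IsStrongEmb h ∧ g.comp A.emb = h.comp B.emb ∧ g A.pt = h B.pt

/-- The Galois types over `M`: pointed strong extensions of `M` modulo the equivalence
relation generated by `PointedExt.Rel` (under amalgamation, `PointedExt.Rel` is itself an
equivalence relation, and the classes correspond to the orbits, in a monster model, of the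
automorphisms fixing `M`). -/
def GaS (M : Type u) [L.Structure M] : Type (u + 1) :=
  Quot (PointedExt.Rel (K := K) (M := M))

variable {K} in
/-- View a pointed strong extension of `M` as one of a strong submodel `S` of `M`. -/
def PointedExt.restrict {M : Type u} [L.Structure M] {S : L.Substructure M} (hS : K.Strong S)
    (A : K.PointedExt M) : K.PointedExt S where
  carrier := A.carrier
  emb := A.emb.comp S.subtype
  strong := A.strong.comp (Strong.isStrongEmb_subtype hS)
  pt := A.pt

variable {K} in
/-- The restriction of a Galois type over `M` to a strong submodel `S` of `M`. -/
def GaS.restrict {M : Type u} [L.Structure M] {S : L.Substructure M} (hS : K.Strong S) :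
    K.GaS M → K.GaS S :=
  Quot.map (PointedExt.restrict hS) (by
    rintro A B ⟨P, _, g, h, hg, hh, hc, hp⟩
    refine ⟨P, _, g, h, hg, hh, ?_, hp⟩
    ext x
    exact DFunLike.congr_fun hc (S.subtype x))

/-- `χ`-tameness: distinct Galois types over a model are already distinct over some strong
submodel of cardinality at most `χ`. -/
def Tame (χ : Cardinal.{u}) : Prop :=
  ∀ (M : Type u) [L.Structure M], K.Mem M → ∀ p q : K.GaS M, p ≠ q →
    ∃ (S : L.Substructure M) (hS : K.Strong S),
      #S ≤ χ ∧ GaS.restrict hS p ≠ GaS.restrict hS q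

/-- Galois stability in `ν`: over every model of cardinality `ν` there are exactly `ν` Galois
types. -/
def Stable (ν : Cardinal.{u}) : Prop :=
  ∀ (M : Type u) [L.Structure M], K.Mem M → #M = ν → #(K.GaS M) = Cardinal.lift.{u + 1} ν

end AEC

/-! Write λ for `lam`, and call a model small if its size is at most λ. Suppose some M of size μ
carries more than μ types. Since λ < cf(μ), each small submodel lies in one of μ many strong
submodels whose sizes are in `C`. Stability there gives fewer than μ types over each, so at most μ
types over M have a small restriction with at most μ extensions (`mk_setOf_few_extensions_le`).
Discard these bad types: for each remaining p, every small restriction still has more than μ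
extensions among the remaining types. By tameness, λ of these extensions are already distinct over a
single small model (`Tame.exists_injective_restrict`).

Iterating this splitting gives a tree indexed by the finite sequences from λ. There are only λ
nodes, so one strong N of size λ contains all their models. Each branch is a coherent ω-sequence of
types. Such a sequence has an upper bound, by amalgamation and unions of chains
(`exists_limit_type`), and distinct branches have distinct bounds. So N carries at least λ^ℵ₀ > λ
types, against stability in λ. -/

namespace AEC

variable {L : FirstOrder.Language.{u, u}} {K : AEC L}

/-! ### Strong embeddings -/

theorem IsStrongEmb.mem_left {M N : Type u} [L.Structure M] [L.Structure N] {f : M ↪[L] N}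
    (hf : K.IsStrongEmb f) : K.Mem M :=
  K.mem_iso f.equivRange.symm (K.mem_of_strong hf).1

theorem IsStrongEmb.mem_right {M N : Type u} [L.Structure M] [L.Structure N] {f : M ↪[L] N}
    (hf : K.IsStrongEmb f) : K.Mem N :=
  (K.mem_of_strong hf).2

theorem isStrongEmb_equiv {M N : Type u} [L.Structure M] [L.Structure N] (e : M ≃[L] N)
    (hM : K.Mem M) : K.IsStrongEmb e.toEmbedding := by
  have h : e.toEmbedding.toHom.range = ⊤ := Hom.range_eq_top.2 e.surjective
  unfold IsStrongEmb
  rw [h]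
  exact K.strong_refl (K.mem_iso e hM)

theorem isStrongEmb_refl {M : Type u} [L.Structure M] (hM : K.Mem M) :
    K.IsStrongEmb (Embedding.refl L M) :=
  isStrongEmb_equiv (Language.Equiv.refl L M) hM

theorem range_inclusion {M : Type u} [L.Structure M] {S T : L.Substructure M} (h : S ≤ T) :
    (Substructure.inclusion h).toHom.range = S.comap T.subtype.toHom := by
  ext x
  simp only [Hom.mem_range, Substructure.mem_comap]
  constructor
  · rintro ⟨y, rfl⟩
    exact y.2
  · intro hx
    exact ⟨⟨x, hx⟩, rfl⟩

theorem isStrongEmb_inclusion_iff {M : Type u} [L.Structure M] {S T : L.Substructure M}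
    (h : S ≤ T) :
    K.IsStrongEmb (Substructure.inclusion h) ↔ K.Strong (S.comap T.subtype.toHom) := by
  rw [IsStrongEmb, range_inclusion]

theorem Strong.isStrongEmb_inclusion {M : Type u} [L.Structure M] {S T : L.Substructure M}
    (hS : K.Strong S) (hT : K.Strong T) (h : S ≤ T) :
    K.IsStrongEmb (Substructure.inclusion h) :=
  (isStrongEmb_inclusion_iff h).2 (K.coherence hS hT h)

/-! ### Unions and direct limits of ω-chains -/

/-- Unions of chains of length `ω`. -/
theorem chain_nat {U : Type u} [L.Structure U] (S : ℕ → L.Substructure U) (hS : Monotone S)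
    (hstr : ∀ i j (h : i ≤ j), K.IsStrongEmb (Substructure.inclusion (hS h)))
    (T : L.Substructure U) (hT : (T : Set U) = ⋃ i, (S i : Set U)) :
    (∀ i, K.Strong ((S i).comap T.subtype.toHom)) ∧ ((∀ i, K.Strong (S i)) → K.Strong T) := by
  obtain ⟨-, h₁, h₂⟩ := K.chain (fun i : ULift.{u} ℕ => S i.down) T
    (fun i j h => ⟨hS h, (isStrongEmb_inclusion_iff _).1 (hstr _ _ h)⟩)
    (fun i hi => by
      -- ω has no limit points, so the continuity condition is vacuous.
      exfalso
      obtain ⟨n⟩ := i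
      have hn : Order.IsSuccLimit n := by
        refine ⟨fun h => hi.1 fun b hb => h hb, fun a ha => hi.2 ⟨a⟩ ⟨ha.1, fun c hc hc' => ha.2 hc hc'⟩⟩
      exact Order.not_isSuccLimit_of_isSuccArchimedean hn)
    (by
      rw [hT]
      exact (Equiv.ulift.surjective.iUnion_comp fun i => (S i : Set U)).symm)
  exact ⟨fun i => h₁ ⟨i⟩, fun h => h₂ fun i => h _⟩

theorem isStrongEmb_natLERec {G : ℕ → Type u} [∀ i, L.Structure (G i)]
    (f : ∀ n, G n ↪[L] G (n + 1)) (hf : ∀ n, K.IsStrongEmb (f n)) (m n : ℕ) (h : m ≤ n) :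
    K.IsStrongEmb (DirectedSystem.natLERec f m n h) := by
  induction n, h using Nat.le_induction with
  | base =>
    rw [DirectedSystem.natLERec, Nat.leRecOn_self]
    exact isStrongEmb_refl (hf m).mem_left
  | succ n h ih =>
    rw [DirectedSystem.natLERec, Nat.leRecOn_succ h]
    exact (hf n).comp ih

/-- Direct limits of sequences of strong embeddings. -/
theorem exists_limit_nat {G : ℕ → Type u} [∀ i, L.Structure (G i)]
    (f : ∀ n, G n ↪[L] G (n + 1)) (hf : ∀ n, K.IsStrongEmb (f n)) :
    ∃ (P : Type u) (_ : L.Structure P) (h : ∀ n, G n ↪[L] P),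
      (∀ n, K.IsStrongEmb (h n)) ∧ ∀ n, (h (n + 1)).comp (f n) = h n := by
  let F := fun i j h => DirectedSystem.natLERec f i j h
  let o := fun n => DirectLimit.of L ℕ G F n
  have ho : ∀ i j (h : i ≤ j), (o j).comp (F i j h) = o i := fun i j h => by
    ext x
    exact DirectLimit.of_f
  have hmono : Monotone fun n => (o n).toHom.range := by
    rintro i j h _ ⟨x, rfl⟩
    refine ⟨F i j h x, ?_⟩
    exact DFunLike.congr_fun (ho i j h) x
  have key := K.chain_nat (fun n => (o n).toHom.range) hmono (fun i j h => by
      -- The inclusion between two images is `F i j h` conjugated by the isomorphisms onto the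
      -- images.
      have h₁ : K.IsStrongEmb ((o j).equivRange.toEmbedding.comp
          ((F i j h).comp (o i).equivRange.symm.toEmbedding)) :=
        (isStrongEmb_equiv _ (hf j).mem_left).comp
          ((isStrongEmb_natLERec f hf i j h).comp
            (isStrongEmb_equiv _ (K.mem_iso (o i).equivRange (hf i).mem_left)))
      convert h₁ using 1
      ext x
      obtain ⟨y, rfl⟩ := (o i).equivRange.surjective x
      have e : (o i).equivRange.symm ((o i).equivRange y) = y :=
        (o i).equivRange.symm_apply_apply y
      change o i y = o j (F i j h ((o i).equivRange.symm ((o i).equivRange y)))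
      rw [e]
      exact (DFunLike.congr_fun (ho i j h) y).symm) ⊤ (by
      symm
      refine Set.eq_univ_iff_forall.2 fun x => ?_
      obtain ⟨i, y, rfl⟩ := DirectLimit.exists_of x
      exact Set.mem_iUnion.2 ⟨i, y, rfl⟩)
  refine ⟨Language.DirectLimit G F, inferInstance, o, fun n => ?_, fun n => ?_⟩
  -- The images exhaust the limit, so the chain axiom makes each strong in `⊤`; this is transported
  -- to the limit itself.
  · have h := K.strong_iso Substructure.topEquiv (key.1 n)
    unfold IsStrongEmb
    convert h using 1
    ext x
    simp only [Substructure.mem_map, Substructure.mem_comap]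
    constructor
    · intro hx
      exact ⟨⟨x, trivial⟩, hx, rfl⟩
    · rintro ⟨y, hy, rfl⟩
      exact hy
  · rw [← ho n (n + 1) n.le_succ]
    ext x
    change o (n + 1) (f n x) = o (n + 1) (F n (n + 1) n.le_succ x)
    congr 1
    change _ = DirectedSystem.natLERec f n (n + 1) n.le_succ x
    rw [DirectedSystem.natLERec, Nat.leRecOn_succ le_rfl, Nat.leRecOn_self]
    rfl

/-! ### Galois types under amalgamation -/

/-- View a pointed strong extension of `M` as one of `S`, along a strong embedding of `S`
into `M`. -/
def PointedExt.comap {S M : Type u} [L.Structure S] [L.Structure M] (i : S ↪[L] M)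
    (hi : K.IsStrongEmb i) (A : K.PointedExt M) : K.PointedExt S where
  carrier := A.carrier
  emb := A.emb.comp i
  strong := A.strong.comp hi
  pt := A.pt

theorem PointedExt.Rel.refl {M : Type u} [L.Structure M] (A : K.PointedExt M) : A.Rel A :=
  ⟨A.carrier, A.str, Embedding.refl L _, Embedding.refl L _,
    isStrongEmb_refl A.strong.mem_right, isStrongEmb_refl A.strong.mem_right, rfl, rfl⟩

theorem PointedExt.Rel.symm {M : Type u} [L.Structure M] {A B : K.PointedExt M} (h : A.Rel B) :
    B.Rel A := by
  obtain ⟨P, _, f, g, hf, hg, e, hp⟩ := h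
  exact ⟨P, _, g, f, hg, hf, e.symm, hp.symm⟩

/-- The two witnessing structures are amalgamated over the carrier of the middle extension `B`. -/
theorem PointedExt.Rel.trans (hAP : K.AP) {M : Type u} [L.Structure M] {A B C : K.PointedExt M}
    (h₁ : A.Rel B) (h₂ : B.Rel C) : A.Rel C := by
  obtain ⟨P, _, f, g, hf, hg, e, hp⟩ := h₁
  obtain ⟨Q, _, f', g', hf', hg', e', hp'⟩ := h₂
  obtain ⟨R, _, r, s, hr, hs, e''⟩ := hAP _ _ _ g f' hg hf'
  refine ⟨R, _, r.comp f, s.comp g', hr.comp hf, hs.comp hg', ?_, ?_⟩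
  · rw [Embedding.comp_assoc, e, ← Embedding.comp_assoc, e'', Embedding.comp_assoc, e',
      Embedding.comp_assoc]
  · simp only [Embedding.comp_apply]
    rw [hp, ← hp']
    exact DFunLike.congr_fun e'' B.pt

theorem PointedExt.Rel.comap {S M : Type u} [L.Structure S] [L.Structure M] (i : S ↪[L] M)
    (hi : K.IsStrongEmb i) {A B : K.PointedExt M} (h : A.Rel B) :
    (A.comap i hi).Rel (B.comap i hi) := by
  obtain ⟨P, _, f, g, hf, hg, e, hp⟩ := h
  refine ⟨P, _, f, g, hf, hg, ?_, hp⟩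
  ext x
  exact DFunLike.congr_fun e (i x)

theorem rel_of_mk_eq (hAP : K.AP) {M : Type u} [L.Structure M] {A B : K.PointedExt M}
    (h : (Quot.mk _ A : K.GaS M) = Quot.mk _ B) : A.Rel B := by
  have hE : Equivalence (PointedExt.Rel (K := K) (M := M)) :=
    ⟨PointedExt.Rel.refl, PointedExt.Rel.symm, PointedExt.Rel.trans hAP⟩
  exact hE.eqvGen_iff.1 (Quot.eqvGen_exact h)

/-- By coherence `S` is strong in `T`, so restriction to `S` factors through restriction to `T`. -/
theorem GaS.restrict_eq_of_le (hAP : K.AP) {M : Type u} [L.Structure M] {S T : L.Substructure M}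
    (hS : K.Strong S) (hT : K.Strong T) (h : S ≤ T) {p q : K.GaS M}
    (hpq : GaS.restrict hT p = GaS.restrict hT q) : GaS.restrict hS p = GaS.restrict hS q := by
  induction p using Quot.ind with | mk A => ?_
  induction q using Quot.ind with | mk B => ?_
  exact Quot.sound ((rel_of_mk_eq hAP hpq).comap _ (hS.isStrongEmb_inclusion hT h))

/-- Types extend along strong embeddings. -/
theorem PointedExt.exists_extend (hAP : K.AP) {S M : Type u} [L.Structure S] [L.Structure M]
    (i : S ↪[L] M) (hi : K.IsStrongEmb i) (A : K.PointedExt S) :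
    ∃ B : K.PointedExt M, (B.comap i hi).Rel A := by
  obtain ⟨P, _, f, g, hf, hg, e⟩ := hAP _ _ _ i A.emb hi A.strong
  refine ⟨⟨P, f, hf, g A.pt⟩, P, _, Embedding.refl L _, g, isStrongEmb_refl hf.mem_right, hg, ?_, rfl⟩
  ext x
  exact DFunLike.congr_fun e x

/-- If `B` over `S` and `A` over `T` have the same type over `S`, then some `B'` over `T` of the
same type as `A` extends `B`. -/
theorem PointedExt.exists_step {S T : Type u} [L.Structure S] [L.Structure T] (i : S ↪[L] T)
    (hi : K.IsStrongEmb i) (B : K.PointedExt S) (A : K.PointedExt T)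
    (h : B.Rel (A.comap i hi)) :
    ∃ B' : K.PointedExt T, B'.Rel A ∧ ∃ g : B.carrier ↪[L] B'.carrier,
      K.IsStrongEmb g ∧ g.comp B.emb = B'.emb.comp i ∧ g B.pt = B'.pt := by
  obtain ⟨P, _, f, g, hf, hg, e, hp⟩ := h
  refine ⟨⟨P, g.comp A.emb, hg.comp A.strong, g A.pt⟩, ?_, f, hf, ?_, hp⟩
  · exact ⟨P, _, Embedding.refl L _, g, isStrongEmb_refl hg.mem_right, hg, rfl, rfl⟩
  · rw [e]
    rfl

/-! ### Limits of ω-sequences of types -/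

/-- The union of a chain of strong embeddings of a chain of strong submodels. -/
theorem exists_union_emb {M P : Type u} [L.Structure M] [L.Structure P]
    (S : ℕ →o L.Substructure M) (hS : ∀ n, K.Strong (S n))
    (f : ∀ n, S n ↪[L] P) (hf : ∀ n, K.IsStrongEmb (f n))
    (hc : ∀ m n (h : m ≤ n), (f n).comp (Substructure.inclusion (S.monotone h)) = f m) :
    K.Strong (⨆ n, S n) ∧ ∃ g : (⨆ n, S n : L.Substructure M) ↪[L] P, K.IsStrongEmb g ∧
      ∀ n, g.comp (Substructure.inclusion (le_iSup S n)) = f n := by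
  have hmem : ∀ x, x ∈ (⨆ n, S n : L.Substructure M) ↔ ∃ n, x ∈ S n := fun x =>
    Substructure.mem_iSup_of_directed S.monotone.directed_le
  have hT := K.chain_nat S S.monotone
    (fun i j h => (hS i).isStrongEmb_inclusion (hS j) (S.monotone h)) (⨆ n, S n) (by
      ext x
      rw [Set.mem_iUnion]
      exact hmem x)
  refine ⟨hT.2 hS, ?_⟩
  let l := Language.DirectLimit.lift L ℕ (fun n => S n)
    (fun _ _ h => Substructure.inclusion (S.monotone h)) f
    (fun i j h x => DFunLike.congr_fun (hc i j h) x)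
  let g : (⨆ n, S n : L.Substructure M) ↪[L] P :=
    l.comp (Language.DirectLimit.Equiv_iSup S).symm.toEmbedding
  have hg : ∀ n, g.comp (Substructure.inclusion (le_iSup S n)) = f n := fun n => by
    ext x
    exact (congrArg l (Language.DirectLimit.Equiv_isup_symm_inclusion_apply S x)).trans
      (Language.DirectLimit.lift_of (G := fun n => S n)
        (f := fun _ _ h => Substructure.inclusion (S.monotone h)) f _ x)
  refine ⟨g, ?_, hg⟩
  have hle : Monotone fun n => (f n).toHom.range := by
    rintro i j h _ ⟨x, rfl⟩
    exact ⟨Substructure.inclusion (S.monotone h) x, DFunLike.congr_fun (hc i j h) x⟩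
  -- The image of the union is the union of the images, all strong in `P`; the last clause of the
  -- chain axiom applies.
  refine (K.chain_nat (fun n => (f n).toHom.range) hle
    (fun i j h => Strong.isStrongEmb_inclusion (hf i) (hf j) (hle h)) g.toHom.range ?_).2 hf
  ext x
  rw [Set.mem_iUnion]
  constructor
  · rintro ⟨y, rfl⟩
    obtain ⟨n, hn⟩ := (hmem y).1 y.2
    exact ⟨n, ⟨y, hn⟩, (DFunLike.congr_fun (hg n) ⟨y, hn⟩).symm⟩
  · rintro ⟨n, y, rfl⟩
    exact ⟨Substructure.inclusion (le_iSup S n) y, DFunLike.congr_fun (hg n) y⟩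

/-- A coherent sequence of Galois types over an increasing sequence of models has an upper
bound. -/
theorem exists_limit_type (hAP : K.AP) {M : Type u} [L.Structure M]
    (S : ℕ →o L.Substructure M) (hS : ∀ n, K.Strong (S n)) {N : L.Substructure M}
    (hN : K.Strong N) (hSN : ∀ n, S n ≤ N) (p : ℕ → K.GaS M)
    (hp : ∀ n, GaS.restrict (hS n) (p (n + 1)) = GaS.restrict (hS n) (p n)) :
    ∃ X : K.PointedExt N, ∀ n, ∀ A : K.PointedExt M, Quot.mk _ A = p n →
      (X.comap _ ((hS n).isStrongEmb_inclusion hN (hSN n))).Rel (A.restrict (hS n)) := by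
  choose A hA using fun n => Quot.exists_rep (p n)
  have hi : ∀ n, K.IsStrongEmb (Substructure.inclusion (S.monotone (Nat.le_succ n))) := fun n =>
    (hS n).isStrongEmb_inclusion (hS _) _
  have hrel : ∀ n, ((A n).restrict (hS n)).Rel ((A (n + 1)).restrict (hS n)) := fun n => by
    refine rel_of_mk_eq hAP ?_
    have := hp n
    rw [← hA, ← hA] at this
    exact this.symm
  -- Representatives of the types need not map into one another, so each is replaced by an
  -- equivalent one into which its predecessor embeds. This yields a chain with a direct limit.
  have step : ∀ n (B : {B : K.PointedExt (S n) // B.Rel ((A n).restrict (hS n))}),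
      ∃ B' : {B : K.PointedExt (S (n + 1)) // B.Rel ((A (n + 1)).restrict (hS (n + 1)))},
        ∃ g : B.1.carrier ↪[L] B'.1.carrier, K.IsStrongEmb g ∧
        g.comp B.1.emb = B'.1.emb.comp (Substructure.inclusion (S.monotone n.le_succ)) ∧
          g B.1.pt = B'.1.pt := by
    rintro n ⟨B, hB⟩
    obtain ⟨B', hB', h⟩ := PointedExt.exists_step _ (hi n) B ((A (n + 1)).restrict (hS (n + 1)))
      (hB.trans hAP (hrel n))
    exact ⟨⟨B', hB'⟩, h⟩
  choose nxt g hg hge hgp using step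
  let B : ∀ n, {B : K.PointedExt (S n) // B.Rel ((A n).restrict (hS n))} := fun n =>
    Nat.rec ⟨_, PointedExt.Rel.refl _⟩ nxt n
  obtain ⟨P, _, h, hh, hc⟩ := exists_limit_nat (K := K) (G := fun n => (B n).1.carrier)
    (fun n => g n (B n)) (fun n => hg n (B n))
  have hf : ∀ n, K.IsStrongEmb ((h n).comp (B n).1.emb) := fun n => (hh n).comp (B n).1.strong
  have hc' : ∀ m n (hmn : m ≤ n), ((h n).comp (B n).1.emb).comp
      (Substructure.inclusion (S.monotone hmn)) = (h m).comp (B m).1.emb := by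
    intro m n hmn
    induction n, hmn using Nat.le_induction with
    | base => rfl
    | succ n hmn ih =>
      rw [← ih, ← hc n]
      ext x
      exact congrArg (h (n + 1))
        (DFunLike.congr_fun (hge n (B n)) (Substructure.inclusion (S.monotone hmn) x)).symm
  have hpt : ∀ n, h n (B n).1.pt = h 0 (B 0).1.pt := by
    intro n
    induction n with
    | zero => rfl
    | succ n ih =>
      rw [← ih, ← hc n]
      exact congrArg (h (n + 1)) (hgp n (B n)).symm
  obtain ⟨hT, e, he, hen⟩ := exists_union_emb S hS _ hf hc'
  obtain ⟨X, hX⟩ := PointedExt.exists_extend hAP _ (hT.isStrongEmb_inclusion hN (iSup_le hSN))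
    (⟨P, e, he, h 0 (B 0).1.pt⟩ : K.PointedExt _)
  refine ⟨X, fun n A' hA' => ?_⟩
  have h₁ := hX.comap _ ((hS n).isStrongEmb_inclusion hT (le_iSup S n))
  refine PointedExt.Rel.trans hAP h₁ (PointedExt.Rel.trans hAP ?_ ((B n).2.trans hAP
    (rel_of_mk_eq hAP (congrArg (GaS.restrict (hS n)) ((hA n).trans hA'.symm)))))
  exact ⟨P, _, Embedding.refl L _, h n, isStrongEmb_refl (hh n).mem_right, hh n, hen n,
    (hpt n).symm⟩

/-! ### Löwenheim–Skolem and realized types -/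

theorem aleph0_le_LS : ℵ₀ ≤ K.LS :=
  (csInf_mem K.exists_LS).1

theorem exists_strong_card_le {M : Type u} [L.Structure M] (hM : K.Mem M) {lam : Cardinal.{u}}
    (hlam : K.LS ≤ lam) (A : Set M) (hA : #A ≤ lam) :
    ∃ S : L.Substructure M, A ⊆ S ∧ K.Strong S ∧ #S ≤ lam := by
  obtain ⟨S, h₁, h₂, h₃⟩ := (csInf_mem K.exists_LS).2 M hM A
  exact ⟨S, h₁, h₂, h₃.trans (Cardinal.add_le_of_le (aleph0_le_LS.trans hlam) hA hlam)⟩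

theorem exists_strong_card_eq {M : Type u} [L.Structure M] (hM : K.Mem M) {lam : Cardinal.{u}}
    (hlam : K.LS ≤ lam) (hlamM : lam ≤ #M) (A : Set M) (hA : #A ≤ lam) :
    ∃ S : L.Substructure M, A ⊆ S ∧ K.Strong S ∧ #S = lam := by
  obtain ⟨B, hB⟩ := le_mk_iff_exists_set.1 hlamM
  obtain ⟨S, h₁, h₂, h₃⟩ := exists_strong_card_le hM hlam (A ∪ B)
    ((mk_union_le A B).trans (Cardinal.add_le_of_le (aleph0_le_LS.trans hlam) hA hB.le))
  refine ⟨S, Set.subset_union_left.trans h₁, h₂, h₃.antisymm ?_⟩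
  rw [← hB]
  exact mk_le_mk_of_subset (Set.subset_union_right.trans h₁)

/-- There are at least as many Galois types over a model as it has elements. -/
theorem lift_mk_le_mk_GaS {M : Type u} [L.Structure M] (hM : K.Mem M) :
    lift.{u + 1} #M ≤ #(K.GaS M) := by
  let t : M → K.PointedExt M := fun a => ⟨M, Embedding.refl L M, isStrongEmb_refl hM, a⟩
  have ht : Function.Injective fun a => (Quot.mk _ (t a) : K.GaS M) := by
    intro a b hab
    -- Being realized by the image of `a` is invariant under `PointedExt.Rel`, hence well defined on
    -- types without amalgamation.
    have hinv : ∀ A B : K.PointedExt M, A.Rel B → (A.pt = A.emb a) = (B.pt = B.emb a) := by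
      rintro A B ⟨P, _, g, h, -, -, hc, hp⟩
      have hc' : g (A.emb a) = h (B.emb a) := DFunLike.congr_fun hc a
      rw [← g.injective.eq_iff, ← h.injective.eq_iff, hp, hc']
    have h := congrArg (Quot.lift (fun A : K.PointedExt M => A.pt = A.emb a) hinv) hab
    exact ((cast h rfl : b = a)).symm
  have h := lift_mk_le_lift_mk_of_injective (β := K.GaS M) ht
  rwa [lift_id'.{u, u + 1}] at h

/-! ### The tree of types -/

/-- A set `G` of Galois types over `M` such that every restriction of a member of `G` to a small
model has `lam` extensions in `G` which are distinct over a common small model gives rise to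
`lam ^ ℵ₀` Galois types over a small model. -/
theorem exists_power_aleph0_le_mk_GaS (hAP : K.AP) {M : Type u} [L.Structure M] (hM : K.Mem M)
    {lam : Cardinal.{u}} (hlam : K.LS ≤ lam) (hlamM : lam ≤ #M) (G : Set (K.GaS M))
    (hG : G.Nonempty)
    (hsplit : ∀ p ∈ G, ∀ (S : L.Substructure M) (hS : K.Strong S), #S ≤ lam →
      ∃ (T : L.Substructure M) (hT : K.Strong T), S ≤ T ∧ #T ≤ lam ∧
        ∃ k : lam.out → K.GaS M, (∀ a, k a ∈ G ∧ GaS.restrict hS (k a) = GaS.restrict hS p) ∧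
          Function.Injective fun a => GaS.restrict hT (k a)) :
    ∃ N : L.Substructure M, K.Strong N ∧ #N = lam ∧
      lift.{u + 1} (lam ^ ℵ₀) ≤ #(K.GaS N) := by
  have hinf : ℵ₀ ≤ lam := aleph0_le_LS.trans hlam
  let St := G × {S : L.Substructure M // K.Strong S ∧ #S ≤ lam}
  have hsplit' : ∀ s : St, ∃ (T : {S : L.Substructure M // K.Strong S ∧ #S ≤ lam})
      (k : lam.out → G), s.2.1 ≤ T.1 ∧
        (∀ a, GaS.restrict s.2.2.1 (k a).1 = GaS.restrict s.2.2.1 s.1.1) ∧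
        Function.Injective fun a => GaS.restrict T.2.1 (k a).1 := by
    rintro ⟨⟨p, hp⟩, S, hS, hSc⟩
    obtain ⟨T, hT, hST, hTc, k, hk, hki⟩ := hsplit p hp S hS hSc
    exact ⟨⟨T, hT, hTc⟩, fun a => ⟨k a, (hk a).1⟩, hST, fun a => (hk a).2, hki⟩
  choose T k hST hk hki using hsplit'
  obtain ⟨p₀, hp₀⟩ := hG
  obtain ⟨S₀, -, hS₀, hS₀c⟩ := exists_strong_card_le hM hlam (∅ : Set M) (by simp)
  -- All children of a node share the model `T s`; only the type depends on `a`. Siblings can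
  -- therefore be compared over that model.
  let step : St → lam.out → St := fun s a => (k s a, T s)
  let node : List lam.out → St := fun l => l.foldl step (⟨p₀, hp₀⟩, ⟨S₀, hS₀, hS₀c⟩)
  obtain ⟨N, hN, hNs, hNc⟩ := exists_strong_card_eq hM hlam hlamM
    (⋃ l : List lam.out, ((node l).2.1 : Set M)) (by
      have : Infinite lam.out := by rwa [infinite_iff, mk_out]
      refine (mk_iUnion_le_sum_mk).trans ((sum_le_sum _ (fun _ => lam) fun l =>
        (node l).2.2.2).trans ?_)
      rw [sum_const', mk_list_eq_mk, mk_out]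
      exact (mul_eq_self hinf).le)
  refine ⟨N, hNs, hNc, ?_⟩
  let br : (ℕ → lam.out) → ℕ → List lam.out := fun η n => (List.range n).map η
  have hbr : ∀ η n, node (br η (n + 1)) = step (node (br η n)) (η n) := fun η n => by
    simp only [node, br, List.range_succ, List.map_append, List.map_cons, List.map_nil,
      List.foldl_append, List.foldl_cons, List.foldl_nil]
  have hmono : ∀ η, Monotone fun n => (node (br η n)).2.1 := fun η =>
    monotone_nat_of_le_succ fun n => by
      rw [hbr]
      exact hST _
  have hle : ∀ l, (node l).2.1 ≤ N := fun l =>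
    (Set.subset_iUnion (fun l => ((node l).2.1 : Set M)) l).trans hN
  have hlim := fun η => exists_limit_type hAP ⟨fun n => (node (br η n)).2.1, hmono η⟩
    (fun n => (node (br η n)).2.2.1) hNs (fun n => hle _) (fun n => (node (br η n)).1.1)
    (fun n => by
      have := hk (node (br η n)) (η n)
      rw [hbr]
      exact this)
  choose X hX using hlim
  have hinj : Function.Injective fun η => (Quot.mk _ (X η) : K.GaS N) := by
    intro η η' h
    by_contra hne
    have hex : ∃ n, η n ≠ η' n := Function.ne_iff.1 hne
    classical
    have hmin : ∀ m < Nat.find hex, η m = η' m := fun m hm => not_not.1 (Nat.find_min hex hm)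
    have hn := Nat.find_spec hex
    generalize Nat.find hex = n at hmin hn
    have hb : br η n = br η' n :=
      List.map_congr_left fun m hm => hmin m (List.mem_range.1 hm)
    -- At the first disagreement `n` both branches pass through the same node, and each limit type
    -- restricts to its chosen child over the common model `T`.
    have hd : ∀ ζ : ℕ → lam.out, br ζ n = br η n → ∀ A : K.PointedExt M,
        Quot.mk _ A = (k (node (br η n)) (ζ n)).1 →
        ((X ζ).comap _ ((T (node (br η n))).2.1.isStrongEmb_inclusion hNs
          (by simpa only [hbr] using hle (br η (n + 1))))).Rel
          (A.restrict (T (node (br η n))).2.1) := by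
      intro ζ hζ A hA
      have hs : ∀ s : St, s = node (br ζ (n + 1)) → ∀ hsN : s.2.1 ≤ N, Quot.mk _ A = s.1.1 →
          ((X ζ).comap _ (s.2.2.1.isStrongEmb_inclusion hNs hsN)).Rel (A.restrict s.2.2.1) := by
        rintro _ rfl _ h
        exact hX ζ (n + 1) A h
      exact hs (step (node (br η n)) (ζ n)) (by rw [hbr, hζ]) _ hA
    obtain ⟨A, hA⟩ := Quot.exists_rep (k (node (br η n)) (η n)).1
    obtain ⟨A', hA'⟩ := Quot.exists_rep (k (node (br η n)) (η' n)).1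
    have h₁ := hd η rfl A hA
    have h₂ := hd η' hb.symm A' hA'
    have h₃ := (rel_of_mk_eq hAP h).comap _ ((T (node (br η n))).2.1.isStrongEmb_inclusion hNs
          (by simpa only [hbr] using hle (br η (n + 1))))
    refine hn (hki (node (br η n)) ?_)
    change GaS.restrict _ _ = GaS.restrict _ _
    rw [← hA, ← hA']
    exact Quot.sound (h₁.symm.trans hAP (h₃.trans hAP h₂))
  have h := lift_mk_le_lift_mk_of_injective (β := K.GaS N) hinj
  rw [lift_id'.{u, u + 1}, mk_arrow] at h
  simpa using h

/-! ### Few bad types, tameness, and covering by stable submodels -/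

/-- In a model of size `μ`, the Galois types whose restriction to some small model has few
extensions are few. -/
theorem mk_setOf_few_extensions_le (hAP : K.AP) {M : Type u} [L.Structure M]
    {lam : Cardinal.{u}} {μ : Cardinal.{u + 1}} (hμ : ℵ₀ ≤ μ) (hM : lift.{u + 1} #M ≤ μ)
    (F : M → L.Substructure M) (hF : ∀ x, K.Strong (F x))
    (hFc : ∀ x, #(K.GaS (F x)) ≤ μ)
    (hFle : ∀ S : L.Substructure M, #S ≤ lam → ∃ x, S ≤ F x) :
    #{p : K.GaS M | ∃ (S : L.Substructure M) (hS : K.Strong S), #S ≤ lam ∧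
      #{q | GaS.restrict hS q = GaS.restrict hS p} ≤ μ} ≤ μ := by
  let J := Σ x, {r : K.GaS (F x) // #{q | GaS.restrict (hF x) q = r} ≤ μ}
  have hJ : #J ≤ μ := by
    rw [mk_sigma]
    refine (sum_le_sum _ (fun _ => μ) fun x => (mk_subtype_le _).trans (hFc x)).trans ?_
    rw [sum_const, lift_id'.{u, u + 1}]
    exact mul_le_of_le hμ hM le_rfl
  have hsub : {p : K.GaS M | ∃ (S : L.Substructure M) (hS : K.Strong S), #S ≤ lam ∧
      #{q | GaS.restrict hS q = GaS.restrict hS p} ≤ μ} ⊆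
      ⋃ j : J, {q | GaS.restrict (hF j.1) q = j.2.1} := by
    rintro p ⟨S, hS, hSc, hp⟩
    obtain ⟨x, hx⟩ := hFle S hSc
    refine Set.mem_iUnion.2 ⟨⟨x, GaS.restrict (hF x) p, (mk_le_mk_of_subset ?_).trans hp⟩, rfl⟩
    -- Enlarging `S` to `F x` can only shrink the set of extensions.
    exact fun q hq => GaS.restrict_eq_of_le hAP hS (hF x) hx hq
  refine (mk_le_mk_of_subset hsub).trans (mk_iUnion_le_sum_mk.trans
    ((sum_le_sum _ (fun _ => μ) fun j => j.2.2).trans ?_))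
  rw [sum_const']
  exact mul_le_of_le hμ hJ le_rfl

/-- Tameness: `lam` many distinct types over `M` are distinct over a small model. -/
theorem Tame.exists_injective_restrict (hAP : K.AP) {χ lam : Cardinal.{u}} (htame : K.Tame χ)
    (hχ : K.LS ≤ χ) (hlam : χ ≤ lam) {M : Type u} [L.Structure M] (hM : K.Mem M)
    {S : L.Substructure M} (hS : #S ≤ lam) {k : lam.out → K.GaS M} (hk : Function.Injective k) :
    ∃ (T : L.Substructure M) (hT : K.Strong T), S ≤ T ∧ #T ≤ lam ∧
      Function.Injective fun a => GaS.restrict hT (k a) := by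
  have hinf : ℵ₀ ≤ lam := (aleph0_le_LS.trans hχ).trans hlam
  have hsep : ∀ c : lam.out × lam.out, ∃ R : L.Substructure M, #R ≤ lam ∧
      (c.1 ≠ c.2 → ∃ hR : K.Strong R, GaS.restrict hR (k c.1) ≠ GaS.restrict hR (k c.2)) := by
    rintro ⟨a, b⟩
    by_cases hab : a = b
    -- On the diagonal `S` is a dummy value.
    · exact ⟨S, hS, fun h => absurd hab h⟩
    · obtain ⟨R, hR, hRc, h⟩ := htame M hM (k a) (k b) (hk.ne hab)
      exact ⟨R, hRc.trans hlam, fun _ => ⟨hR, h⟩⟩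
  choose R hRc hR using hsep
  obtain ⟨T, hT, hTs, hTc⟩ := exists_strong_card_le hM (hχ.trans hlam)
    (S ∪ ⋃ c, (R c : Set M)) (by
      refine (mk_union_le _ _).trans (Cardinal.add_le_of_le hinf hS ?_)
      refine mk_iUnion_le_sum_mk.trans ((sum_le_sum _ (fun _ => lam) hRc).trans ?_)
      rw [sum_const', mk_prod, lift_id, mk_out, mul_eq_self hinf, mul_eq_self hinf])
  refine ⟨T, hTs, Set.subset_union_left.trans hT, hTc, fun a b hab => ?_⟩
  by_contra hne
  obtain ⟨hs, h⟩ := hR (a, b) hne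
  exact h (GaS.restrict_eq_of_le hAP hs hTs
    ((Set.subset_iUnion (fun c => (R c : Set M)) (a, b)).trans
      (Set.subset_union_right.trans hT)) hab)

/-- A model of size `μ` has `μ` many strong submodels, of sizes in a given cofinal set of cardinals
below `μ`, such that every submodel of size at most `lam < cf μ` is contained in one of them. -/
theorem exists_cofinal_family {M : Type u} [L.Structure M] (hM : K.Mem M) {lam κ : Cardinal.{u}}
    (hLS : K.LS ≤ lam) (hlam : lam < (#M).ord.cof) (hκ : κ < #M) {C : Set Cardinal.{u}}
    (hC : C ⊆ Set.Ico κ #M) (hcof : ∀ ν ∈ Set.Ico κ #M, ∃ ν' ∈ C, ν ≤ ν') :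
    ∃ F : M → L.Substructure M, (∀ x, K.Strong (F x) ∧ #(F x) ∈ C) ∧
      ∀ S : L.Substructure M, #S ≤ lam → ∃ x, S ≤ F x := by
  have hlamM : lam < #M := hlam.trans_le (Ordinal.cof_ord_le _)
  obtain ⟨e⟩ := Cardinal.eq.1 (mk_ord_toType #M)
  have hF : ∀ x : M, ∃ S : L.Substructure M, e '' Set.Iio (e.symm x) ⊆ S ∧ K.Strong S ∧
      #S ∈ C := by
    intro x
    have h₁ : #(Set.Iio (e.symm x)) < #M := by
      simpa using mk_Iio_lt (e.symm x) (by simp)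
    -- The size must be at least κ for cofinality of `C`, at least `lam` for Löwenheim–Skolem, and
    -- large enough for the initial segment.
    obtain ⟨ν, hν, hle⟩ := hcof (max (max κ lam) #(Set.Iio (e.symm x)))
      ⟨le_max_of_le_left (le_max_left _ _), max_lt (max_lt hκ hlamM) h₁⟩
    obtain ⟨S, hS, hSs, hSc⟩ := exists_strong_card_eq hM
      (hLS.trans (((le_max_right _ _).trans (le_max_left _ _)).trans hle)) (hC hν).2.le
      (e '' Set.Iio (e.symm x)) (mk_image_le.trans ((le_max_right _ _).trans hle))
    exact ⟨S, hS, hSs, hSc ▸ hν⟩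
  choose F hFi hFs hFc using hF
  refine ⟨F, fun x => ⟨hFs x, hFc x⟩, fun S hS => ?_⟩
  -- A set of size below the cofinality is bounded in the enumeration of `M` in order type
  -- `(#M).ord`, so some initial segment contains it.
  have hnc : ¬ IsCofinal (e.symm '' (S : Set M)) := fun h => by
    have := (Order.cof_le h).trans (mk_image_le.trans hS)
    rw [Ordinal.cof_toType] at this
    exact this.not_gt hlam
  obtain ⟨x, hx⟩ := not_isCofinal_iff.1 hnc
  refine ⟨e x, fun y hy => hFi _ ⟨e.symm y, ?_, e.apply_symm_apply y⟩⟩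
  rw [e.symm_apply_apply]
  exact hx _ ⟨y, hy, rfl⟩

end AEC

/-! ### The stability transfer -/

theorem theorem5p10 {L : FirstOrder.Language.{u, u}} (K : AEC L) (hAP : K.AP) (hJEP : K.JEP)
    (χ lam : Cardinal.{u}) (hχ : K.LS ≤ χ) (htame : K.Tame χ)
    (hlam : χ ≤ lam) (hpow : lam < lam ^ ℵ₀) (hstab : K.Stable lam)
    (μ : Cardinal.{u}) (hμ : lam < μ.ord.cof)
    (κ : Cardinal.{u}) (hκ : κ < μ) (C : Set Cardinal.{u}) (hC : C ⊆ Set.Ico κ μ)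
    (hcof : ∀ ν ∈ Set.Ico κ μ, ∃ ν' ∈ C, ν ≤ ν') (hCstab : ∀ ν ∈ C, K.Stable ν) :
    K.Stable μ := by
  intro M _ hM hMc
  subst hMc
  refine le_antisymm ?_ (AEC.lift_mk_le_mk_GaS hM)
  by_contra! hlt
  have hlamM : lam < #M := hμ.trans_le (Ordinal.cof_ord_le _)
  have hinf : ℵ₀ ≤ lift.{u + 1} #M :=
    aleph0_le_lift.2 ((AEC.aleph0_le_LS.trans (hχ.trans hlam)).trans hlamM.le)
  obtain ⟨F, hF, hFle⟩ := AEC.exists_cofinal_family hM (hχ.trans hlam) hμ hκ hC hcof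
  have hbad := AEC.mk_setOf_few_extensions_le hAP hinf le_rfl F (fun x => (hF x).1)
    (fun x => by
      rw [hCstab _ (hF x).2 (F x) (K.mem_of_strong (hF x).1).1 rfl]
      exact lift_le.2 (hC (hF x).2).2.le) hFle
  set B := {p : K.GaS M | ∃ (S : L.Substructure M) (hS : K.Strong S), #S ≤ lam ∧
      #{q | AEC.GaS.restrict hS q = AEC.GaS.restrict hS p} ≤ lift.{u + 1} #M} with hB
  have hdiff : ∀ s : Set (K.GaS M), lift.{u + 1} #M < #s →
      lift.{u + 1} #M < #(s \ B : Set (K.GaS M)) := by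
    intro s hs
    by_contra! h
    exact hs.not_ge ((le_mk_sdiff_add_mk s B).trans (Cardinal.add_le_of_le hinf h hbad))
  obtain ⟨N, hN, hNc, hle⟩ := AEC.exists_power_aleph0_le_mk_GaS hAP hM (hχ.trans hlam) hlamM.le
    Bᶜ (by
      have := hdiff Set.univ (by rwa [mk_univ])
      rw [← Set.compl_eq_univ_sdiff] at this
      exact Set.nonempty_coe_sort.1 (mk_ne_zero_iff.1 (pos_of_gt this).ne')) (by
      intro p hp S hS hSc
      -- As `p` is not in `B`, its restriction to `S` has more than μ extensions, and removing the
      -- at most μ members of `B` leaves more than μ.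
      have h := hdiff {q | AEC.GaS.restrict hS q = AEC.GaS.restrict hS p} (by
        by_contra! h
        exact hp ⟨S, hS, hSc, h⟩)
      have h' : lift.{u + 1} #lam.out ≤ lift.{u} #({q | AEC.GaS.restrict hS q =
          AEC.GaS.restrict hS p} \ B : Set (K.GaS M)) := by
        rw [mk_out, lift_id'.{u, u + 1}]
        exact (lift_le.2 hlamM.le).trans h.le
      obtain ⟨k⟩ := lift_mk_le'.1 h'
      obtain ⟨T, hT, hST, hTc, hinj⟩ := htame.exists_injective_restrict hAP hχ hlam hM hSc
        (k := fun a => (k a).1) (Subtype.val_injective.comp k.injective)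
      exact ⟨T, hT, hST, hTc, fun a => (k a).1, fun a => ⟨(k a).2.2, (k a).2.1⟩, hinj⟩)
  rw [hstab N (K.mem_of_strong hN).1 hNc] at hle
  exact (lift_le.1 hle).not_gt hpow
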